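/- **Model.** A sporadic task system has tasks $\tau_1,\dots,\tau_N$; task $\tau_i$ has worst-case execution time $C_i>0$, relative deadline $D_i>0$ and minimum inter-arrival time $T_i>0$, with $C_i\le D_i$ and $C_i\le T_i$; there is no relation between $D_i$ and $T_i$. Consecutive jobs of $\tau_i$ arrive at least $T_i$ time units apart, the first one not before time $0$, and each job needs at most $C_i$ units of execution. The tasks are executed by preemptive global fixed-priority scheduling on $M\ge 2$ identical unit-speed processors, $\tau_i$ having higher priority than $\tau_j$ iff $i<j$: at every instant the $M$ highest-priority tasks with unfinished arrived jobs (all of them, if there are fewer than $M$) are executed, each on one processor; jobs may migrate; at most one job of a task is executed at any time, and the jobs of a task are executed in the order of their arrival. Task $\tau_k$ is *schedulable* if, for every legal sequence of jobs and every such schedule, every job of $\tau_k$ arriving at time $t$ finishes no later than $t+D_k$. Put $U_i=C_i/T_i$, $\delta_k=C_k/\min\{D_k,T_k\}$ and $U^{\max}_{\delta,k}=\max\{\max_{1\le i<k}U_i,\ \delta_k\}$ (which is $\delta_1$ for $k=1$). **Theorem 4.7.** Let $M\ge 2$ and $1\le k\le N$. Task $\tau_k$ is schedulable by the given global fixed-priority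 scheduling if $$\delta_k+\sum_{i=1}^{k-1}\left(\frac{C_i-C_iU_i}{D_k}+U_i\right)\le M-(M-1)\,U^{\max}_{\delta,k}.$$ Moreover, this condition can be tested in linear time: there are a fixed program of a unit-cost real RAM (arithmetic operations and comparisons of real numbers at unit cost) and a constant $c$ such that for all $M$, all task systems and all $k$ the program, given $k$, $M$ and the numbers $C_i,D_i,T_i$, decides within $c\,k$ steps whether the inequality holds. -/

import Mathlib

open MeasureTheory

noncomputable section

/-! ### Sporadic task systems -/

/-- An arbitrary-deadline sporadic task system with `N` tasks. Task `i` has worst-case execution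
time `C i`, relative deadline `D i` and minimum inter-arrival time `T i`. Priorities are unique and
given by the index: task `i` has higher priority than task `j` iff `i < j`. -/
structure TaskSystem (N : ℕ) where
  C : Fin N → ℝ
  D : Fin N → ℝ
  T : Fin N → ℝ
  C_pos : ∀ i, 0 < C i
  D_pos : ∀ i, 0 < D i
  T_pos : ∀ i, 0 < T i
  C_div_D_le_one : ∀ i, C i / D i ≤ 1
  C_div_T_le_one : ∀ i, C i / T i ≤ 1

namespace TaskSystem

variable {N : ℕ}

/-- The utilization `U i = C i / T i`. -/
def util (τ : TaskSystem N) (i : Fin N) : ℝ := τ.C i / τ.T i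

/-- The density `δ i = C i / min {D i, T i}`. -/
def density (τ : TaskSystem N) (i : Fin N) : ℝ := τ.C i / min (τ.D i) (τ.T i)

/-- `max {max_{i < k} U i, δ k}`; this is `δ k` if there is no task `i < k`. -/
def maxUtilDensity (τ : TaskSystem N) (k : Fin N) : ℝ :=
  (Finset.Iio k).fold max (τ.density k) τ.util

/-- The condition of the linear-time test for task `k` on `M` processors. -/
def PassesTest (τ : TaskSystem N) (M : ℕ) (k : Fin N) : Prop :=
  τ.density k + ∑ i ∈ Finset.Iio k, ((τ.C i - τ.C i * τ.util i) / τ.D k + τ.util i)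
    ≤ (M : ℝ) - ((M : ℝ) - 1) * τ.maxUtilDensity k

end TaskSystem

/-- A legal job sequence of a task system: job `j` of task `i` arrives at `arrival i j ≥ 0`, needs
`exec i j ≤ C i` units of execution, and consecutive jobs of task `i` arrive at least `T i`
apart. -/
structure JobSequence {N : ℕ} (τ : TaskSystem N) where
  arrival : Fin N → ℕ → ℝ
  exec : Fin N → ℕ → ℝ
  arrival_nonneg : ∀ i, 0 ≤ arrival i 0
  arrival_add_le : ∀ i j, arrival i j + τ.T i ≤ arrival i (j + 1)
  exec_nonneg : ∀ i j, 0 ≤ exec i j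
  exec_le : ∀ i j, exec i j ≤ τ.C i

/-! ### Schedules on `M` identical processors -/

/-- `σ p t` is the job executed on processor `p` at time `t` (`none` if `p` is idle); the pair
`(i, j)` stands for job `j` of task `i`. Jobs may be preempted and may migrate at any time. -/
abbrev Schedule (M N : ℕ) : Type := Fin M → ℝ → Option (Fin N × ℕ)

namespace Schedule

variable {M N : ℕ}

/-- The set of times at which job `J` is executed on some processor. -/
def runSet (σ : Schedule M N) (J : Fin N × ℕ) : Set ℝ := {t | ∃ p, σ p t = some J}

/-- The amount of time for which job `J` is executed during `[0, t)`. -/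
def service (σ : Schedule M N) (J : Fin N × ℕ) (t : ℝ) : ℝ :=
  volume.real (Set.Ico 0 t ∩ σ.runSet J)

/-- Job `j` of task `i` has arrived before or at time `t` and has not finished yet at time `t`. -/
def Pending (σ : Schedule M N) {τ : TaskSystem N} (ω : JobSequence τ) (i : Fin N) (j : ℕ)
    (t : ℝ) : Prop :=
  ω.arrival i j ≤ t ∧ σ.service (i, j) t < ω.exec i j

/-- Task `i` is active at time `t`: at least one of its jobs has arrived and has not finished. -/
def Active (σ : Schedule M N) {τ : TaskSystem N} (ω : JobSequence τ) (i : Fin N) (t : ℝ) : Prop :=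
  ∃ j, σ.Pending ω i j t

/-- `σ` is a preemptive global fixed-priority schedule of the job sequence `ω`: at every instant
the `M` highest-priority active tasks (or all active tasks, if there are fewer than `M`) are
executed, each of them on one processor, with its jobs in the order of their arrival. -/
structure IsGlobalFP (σ : Schedule M N) {τ : TaskSystem N} (ω : JobSequence τ) : Prop where
  measurableSet_runSet : ∀ J, MeasurableSet (σ.runSet J)
  /-- Only jobs that have arrived and are not finished are executed. -/
  pending : ∀ p t i j, σ p t = some (i, j) → σ.Pending ω i j t
  /-- No intra-task parallelism: a task occupies at most one processor at a time. -/
  sequential : ∀ p q t i j j', σ p t = some (i, j) → σ q t = some (i, j') → p = q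
  /-- Jobs of the same task are executed first-come first-served. -/
  fifo : ∀ p t i j, σ p t = some (i, j) → ∀ j' < j, ¬ σ.Pending ω i j' t
  /-- An active task is not executed only if all processors execute higher-priority tasks. -/
  priority : ∀ t i, σ.Active ω i t → (∀ p j, σ p t ≠ some (i, j)) →
    ∀ p, ∃ i' j', i' < i ∧ σ p t = some (i', j')

end Schedule

/-- Task `k` is schedulable by preemptive global fixed-priority scheduling on `M` processors: in
every global fixed-priority schedule of every legal job sequence, every job of task `k` finishes
no later than its absolute deadline. -/
def TaskSystem.Schedulable {N : ℕ} (τ : TaskSystem N) (M : ℕ) (k : Fin N) : Prop :=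
  ∀ (ω : JobSequence τ) (σ : Schedule M N), σ.IsGlobalFP ω →
    ∀ j, ω.exec k j ≤ σ.service (k, j) (ω.arrival k j + τ.D k)

/-! ### The unit-cost real RAM -/

namespace RealRAM

/-- The arithmetic operations on real registers. -/
inductive Op
  | add | sub | mul | div

/-- Semantics of the arithmetic operations (division by zero returns zero). -/
def Op.eval : Op → ℝ → ℝ → ℝ
  | .add, x, y => x + y
  | .sub, x, y => x - y
  | .mul, x, y => x * y
  | .div, x, y => x / y

/-- Instructions. There are real registers, index registers holding natural numbers, and a memory
of real numbers which is addressed through the index registers. -/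
inductive Instr
  /-- real register `d` := the natural number `n` -/
  | const (d n : ℕ)
  /-- real register `d` := (real register `a`) `o` (real register `b`) -/
  | arith (o : Op) (d a b : ℕ)
  /-- real register `d` := memory cell addressed by index register `i` -/
  | load (d i : ℕ)
  /-- memory cell addressed by index register `i` := real register `a` -/
  | store (i a : ℕ)
  /-- index register `d` := `n` -/
  | iconst (d n : ℕ)
  /-- index register `d` := (index register `a`) + (index register `b`) -/
  | iadd (d a b : ℕ)
  /-- jump to `l` if (real register `a`) ≤ (real register `b`) -/
  | jle (a b l : ℕ)
  /-- jump to `l` if (index register `a`) ≤ (index register `b`) -/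
  | ijle (a b l : ℕ)
  /-- halt with the given answer -/
  | halt (answer : Bool)

/-- A program is a finite list of instructions. -/
abbrev Program : Type := List Instr

/-- Configurations; `out = some b` means that the machine has halted with answer `b`. -/
structure Config where
  pc : ℕ
  reg : ℕ → ℝ
  idx : ℕ → ℕ
  mem : ℕ → ℝ
  out : Option Bool

/-- Execution of one instruction. -/
def Instr.exec (s : Config) : Instr → Config
  | .const d n => { s with pc := s.pc + 1, reg := Function.update s.reg d (n : ℝ) }
  | .arith o d a b =>
      { s with pc := s.pc + 1, reg := Function.update s.reg d (o.eval (s.reg a) (s.reg b)) }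
  | .load d i => { s with pc := s.pc + 1, reg := Function.update s.reg d (s.mem (s.idx i)) }
  | .store i a => { s with pc := s.pc + 1, mem := Function.update s.mem (s.idx i) (s.reg a) }
  | .iconst d n => { s with pc := s.pc + 1, idx := Function.update s.idx d n }
  | .iadd d a b => { s with pc := s.pc + 1, idx := Function.update s.idx d (s.idx a + s.idx b) }
  | .jle a b l => open Classical in
      { s with pc := if s.reg a ≤ s.reg b then l else s.pc + 1 }
  | .ijle a b l => { s with pc := if s.idx a ≤ s.idx b then l else s.pc + 1 }
  | .halt b => { s with out := some b }

/-- One step of the machine. A halted machine stays as it is; a machine whose program counter has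
left the program is stuck without an answer. -/
def step (P : Program) (s : Config) : Config :=
  match s.out with
  | some _ => s
  | none =>
    match P[s.pc]? with
    | some ins => ins.exec s
    | none => s

/-- The initial configuration with natural-number input `n` (in index register `0`) and
real-number input `x` (in the memory). All other registers are `0`. -/
def init (n : ℕ) (x : ℕ → ℝ) : Config where
  pc := 0
  reg := fun _ => 0
  idx := fun i => if i = 0 then n else 0
  mem := x
  out := none

/-- On input `n`, `x` the program `P` halts within `t` steps, and its answer is `true` iff `A`
holds. -/
def DecidesWithin (P : Program) (n : ℕ) (x : ℕ → ℝ) (t : ℕ) (A : Prop) : Prop :=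
  ∃ s ≤ t, ∃ b : Bool, ((step P)^[s] (init n x)).out = some b ∧ (b = true ↔ A)

end RealRAM

/-- The parameters of a scheduling problem as the memory of a real RAM: cell `0` holds the number
`M` of processors, and cells `3i+1`, `3i+2`, `3i+3` hold `C i`, `D i`, `T i`. -/
def TaskSystem.input {N : ℕ} (τ : TaskSystem N) (M : ℕ) : ℕ → ℝ
  | 0 => (M : ℝ)
  | a + 1 =>
    if h : a / 3 < N then
      if a % 3 = 0 then τ.C ⟨a / 3, h⟩
      else if a % 3 = 1 then τ.D ⟨a / 3, h⟩
      else τ.T ⟨a / 3, h⟩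
    else 0

end

/-! Extend the window of a deadline miss to the left. Let job `j` of task `k` miss its deadline `e`,
and go back from its arrival to a time `s` at which task `k` has no carry-in. On `[s, e)` task `k`
is active and receives less than `δ k * (e - s)` of work, so the `M` processors spend more than
`M * (1 - δ k) * (e - s)` on tasks of higher priority.

Put `ρ = max {max_{i < k} U i, δ k}` and `μ = M - (M - 1) * ρ`. Extend the window to the first time
`t₀ ≤ s` that minimizes the higher-priority work in `[0, t)` minus `μ * t`. The interference in
`[t₀, e)` then still exceeds `(μ - δ k) * (e - t₀)`, while on every window `[r, t₀)` the
interference is below `μ * (t₀ - r)`. The latter means that whatever a task `i < k` carries into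
`t₀` has been compensated: since some time `r` without carry-in, task `i` has run at rate at least
`ρ ≥ U i`. Its work in `[t₀, e)` is therefore at most `U i * (e - t₀) + C i * (1 - U i)`, as if it
had no carry-in at `t₀`. Summing over `i < k` contradicts the test. -/

theorem exists_first_isMinOn_Icc {α β : Type*} [LinearOrder α] [TopologicalSpace α]
    [OrderClosedTopology α] [CompactIccSpace α] [LinearOrder β] [TopologicalSpace β]
    [OrderClosedTopology β] {f : α → β} {a b : α} (hab : a ≤ b)
    (hf : ContinuousOn f (Set.Icc a b)) :
    ∃ c ∈ Set.Icc a b, IsMinOn f (Set.Icc a b) c ∧ ∀ x ∈ Set.Ico a c, f c < f x := by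
  obtain ⟨m, hm, hmin⟩ := isCompact_Icc.exists_isMinOn (Set.nonempty_Icc.2 hab) hf
  have hcompact : IsCompact (Set.Icc a b ∩ f ⁻¹' Set.Iic (f m)) :=
    isCompact_Icc.of_isClosed_subset (hf.preimage_isClosed_of_isClosed isClosed_Icc isClosed_Iic)
      Set.inter_subset_left
  obtain ⟨c, ⟨hc, hcm⟩, hleast⟩ := hcompact.exists_isLeast ⟨m, hm, le_rfl⟩
  refine ⟨c, hc, fun x hx => hcm.trans (hmin hx), fun x hx => hcm.trans_lt ?_⟩
  by_contra! hxm
  exact (hleast ⟨⟨hx.1, hx.2.le.trans hc.2⟩, hxm⟩).not_gt hx.2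

theorem mul_measure_le_sum_measure {α ι : Type*} [MeasurableSpace α] {μ : Measure α}
    {F : Finset ι} {R : ι → Set α} [∀ i, DecidablePred (· ∈ R i)]
    (hR : ∀ i ∈ F, MeasurableSet (R i)) {Q : Set α} {m : ℕ}
    (h : ∀ x ∈ Q, m ≤ Finset.card {i ∈ F | x ∈ R i}) : m * μ Q ≤ ∑ i ∈ F, μ (R i) := by
  have hmeas : Measurable fun x => ∑ i ∈ F, (R i).indicator (1 : α → ENNReal) x :=
    F.measurable_fun_sum fun i hi => measurable_one.indicator (hR i hi)
  have hcount : Q ⊆ {x | (m : ENNReal) ≤ ∑ i ∈ F, (R i).indicator 1 x} := fun x hx => by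
    simpa [Set.indicator_apply, Finset.sum_boole] using h x hx
  calc m * μ Q ≤ m * μ {x | (m : ENNReal) ≤ ∑ i ∈ F, (R i).indicator 1 x} := by gcongr
    _ ≤ ∫⁻ x, ∑ i ∈ F, (R i).indicator 1 x ∂μ := mul_meas_ge_le_lintegral hmeas _
    _ = ∑ i ∈ F, μ (R i) := by
      rw [lintegral_finsetSum _ fun i hi => measurable_one.indicator (hR i hi)]
      exact Finset.sum_congr rfl fun i hi => lintegral_indicator_one (hR i hi)

/-- The length of the part of `R` that lies in `[s, e)`. If `R` is the set of times at which some
activity is going on, this is the time spent on it during `[s, e)`. -/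
noncomputable def occupancy (R : Set ℝ) (s e : ℝ) : ℝ := volume.real (Set.Ico s e ∩ R)

section Occupancy

variable {R : Set ℝ} {r s e : ℝ}

theorem occupancy_nonneg : 0 ≤ occupancy R s e := measureReal_nonneg

theorem volume_Ico_inter_ne_top : volume (Set.Ico s e ∩ R) ≠ ⊤ :=
  measure_inter_ne_top_of_left_ne_top measure_Ico_lt_top.ne

theorem occupancy_mono {s' e' : ℝ} (hs : s' ≤ s) (he : e ≤ e') :
    occupancy R s e ≤ occupancy R s' e' :=
  measureReal_mono (Set.inter_subset_inter_left _ (Set.Ico_subset_Ico hs he))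
    volume_Ico_inter_ne_top

theorem occupancy_le_sub (h : s ≤ e) : occupancy R s e ≤ e - s :=
  (measureReal_mono Set.inter_subset_left measure_Ico_lt_top.ne).trans_eq
    (Real.volume_real_Ico_of_le h)

theorem occupancy_eq_zero (h : ∀ t ∈ Set.Ico s e, t ∉ R) : occupancy R s e = 0 := by
  rw [occupancy, (Set.disjoint_left.2 h).inter_eq, measureReal_empty]

theorem occupancy_le_add (R : Set ℝ) (r s e : ℝ) :
    occupancy R r e ≤ occupancy R r s + occupancy R s e := by
  refine (measureReal_mono ?_ ?_).trans (measureReal_union_le _ _)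
  · rw [← Set.union_inter_distrib_right]
    exact Set.inter_subset_inter_left _ Set.Ico_subset_Ico_union_Ico
  · exact measure_union_ne_top volume_Ico_inter_ne_top volume_Ico_inter_ne_top

theorem occupancy_add (hR : MeasurableSet R) (hrs : r ≤ s) (hse : s ≤ e) :
    occupancy R r s + occupancy R s e = occupancy R r e := by
  unfold occupancy
  rw [← Set.Ico_union_Ico_eq_Ico hrs hse, Set.union_inter_distrib_right,
    measureReal_union _ (measurableSet_Ico.inter hR) volume_Ico_inter_ne_top
      volume_Ico_inter_ne_top]
  exact Set.Ico_disjoint_Ico_same.mono Set.inter_subset_left Set.inter_subset_left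

theorem occupancy_compl (hR : MeasurableSet R) (h : s ≤ e) :
    occupancy Rᶜ s e = e - s - occupancy R s e := by
  have := measureReal_inter_add_sdiff (μ := volume) (s := Set.Ico s e) hR measure_Ico_lt_top.ne
  rw [Real.volume_real_Ico_of_le h, Set.sdiff_eq] at this
  exact eq_sub_of_add_eq' this

theorem occupancy_le_sum_of_subset_biUnion {ι : Type*} {F : Finset ι} {Q : ι → Set ℝ}
    (h : ∀ t ∈ Set.Ico s e, t ∈ R → ∃ i ∈ F, t ∈ Q i) :
    occupancy R s e ≤ ∑ i ∈ F, occupancy (Q i) s e := by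
  refine (measureReal_mono (s₂ := ⋃ i ∈ F, Set.Ico s e ∩ Q i) ?_ ?_).trans
    (measureReal_biUnion_finset_le F _)
  · rintro t ⟨ht, htR⟩
    obtain ⟨i, hi, hti⟩ := h t ht htR
    exact Set.mem_biUnion hi ⟨ht, hti⟩
  · exact (measure_biUnion_lt_top F.finite_toSet fun _ _ => volume_Ico_inter_ne_top.lt_top).ne

theorem continuous_occupancy (R : Set ℝ) (r : ℝ) : Continuous (occupancy R r) := by
  refine (LipschitzWith.of_le_add fun s e => ?_).continuous
  rcases le_total s e with hse | hes
  · exact (occupancy_mono le_rfl hse).trans (le_add_of_nonneg_right dist_nonneg)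
  · calc occupancy R r s ≤ occupancy R r e + occupancy R e s := occupancy_le_add R r e s
      _ ≤ occupancy R r e + dist s e := by
        rw [Real.dist_eq, abs_of_nonneg (sub_nonneg.2 hes)]
        gcongr
        exact occupancy_le_sub hes

theorem mul_occupancy_le_sum_occupancy {ι : Type*} {F : Finset ι} {Q : ι → Set ℝ}
    [∀ i, DecidablePred (· ∈ Q i)] (hQ : ∀ i ∈ F, MeasurableSet (Q i)) {m : ℕ}
    (h : ∀ t ∈ Set.Ico s e, t ∈ R → m ≤ Finset.card {i ∈ F | t ∈ Q i}) :
    m * occupancy R s e ≤ ∑ i ∈ F, occupancy (Q i) s e := by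
  classical
  have hcount : ∀ t ∈ Set.Ico s e ∩ R, m ≤ Finset.card {i ∈ F | t ∈ Set.Ico s e ∩ Q i} :=
    fun t ⟨ht, htR⟩ => by simpa only [Set.mem_inter_iff, ht, true_and] using h t ht htR
  have hle := mul_measure_le_sum_measure (μ := volume) (R := fun i => Set.Ico s e ∩ Q i)
    (fun i hi => measurableSet_Ico.inter (hQ i hi)) hcount
  have hreal := ENNReal.toReal_mono
    (ENNReal.sum_ne_top.2 fun _ _ => volume_Ico_inter_ne_top) hle
  rwa [ENNReal.toReal_mul, ENNReal.toReal_natCast,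
    ENNReal.toReal_sum fun _ _ => volume_Ico_inter_ne_top] at hreal

end Occupancy

namespace TaskSystem

variable {N : ℕ} (τ : TaskSystem N)

theorem util_nonneg (i : Fin N) : 0 ≤ τ.util i := (div_pos (τ.C_pos i) (τ.T_pos i)).le

theorem util_le_one (i : Fin N) : τ.util i ≤ 1 := τ.C_div_T_le_one i

theorem util_mul_T (i : Fin N) : τ.util i * τ.T i = τ.C i := div_mul_cancel₀ _ (τ.T_pos i).ne'

theorem density_nonneg (k : Fin N) : 0 ≤ τ.density k :=
  (div_pos (τ.C_pos k) (lt_min (τ.D_pos k) (τ.T_pos k))).le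

theorem util_le_density (k : Fin N) : τ.util k ≤ τ.density k :=
  div_le_div_of_nonneg_left (τ.C_pos k).le (lt_min (τ.D_pos k) (τ.T_pos k)) (min_le_right _ _)

theorem C_le_density_mul_D (k : Fin N) : τ.C k ≤ τ.density k * τ.D k :=
  (div_le_iff₀ (τ.D_pos k)).1 <|
    div_le_div_of_nonneg_left (τ.C_pos k).le (lt_min (τ.D_pos k) (τ.T_pos k)) (min_le_left _ _)

theorem density_le_maxUtilDensity (k : Fin N) : τ.density k ≤ τ.maxUtilDensity k :=
  (Finset.le_fold_max _).2 (.inl le_rfl)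

theorem util_le_maxUtilDensity {i k : Fin N} (h : i < k) : τ.util i ≤ τ.maxUtilDensity k :=
  (Finset.le_fold_max _).2 (.inr ⟨i, Finset.mem_Iio.2 h, le_rfl⟩)

end TaskSystem

namespace JobSequence

variable {N : ℕ} {τ : TaskSystem N} (ω : JobSequence τ) (i : Fin N)

theorem arrival_strictMono : StrictMono (ω.arrival i) :=
  strictMono_nat_of_lt_succ fun j =>
    (lt_add_of_pos_right _ (τ.T_pos i)).trans_le (ω.arrival_add_le i j)

theorem zero_le_arrival (j : ℕ) : 0 ≤ ω.arrival i j :=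
  (ω.arrival_nonneg i).trans ((ω.arrival_strictMono i).monotone j.zero_le)

theorem sub_mul_T_le {a n : ℕ} (h : a ≤ n) :
    ((n : ℝ) - a) * τ.T i ≤ ω.arrival i n - ω.arrival i a := by
  induction n, h using Nat.le_induction with
  | base => simp
  | succ n _ ih => push_cast; linarith [ω.arrival_add_le i n]

theorem exists_le_arrival (t : ℝ) : ∃ j, t ≤ ω.arrival i j := by
  obtain ⟨n, hn⟩ := exists_nat_ge (t / τ.T i)
  have hgap := ω.sub_mul_T_le i n.zero_le
  rw [div_le_iff₀ (τ.T_pos i)] at hn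
  rw [Nat.cast_zero, sub_zero] at hgap
  exact ⟨n, by linarith [ω.arrival_nonneg i]⟩

theorem exists_last_arrival_lt {j : ℕ} {e : ℝ} (h : ω.arrival i j < e) :
    ∃ n, ω.arrival i n < e ∧ ∀ m, ω.arrival i m < e → m ≤ n := by
  obtain ⟨b, hb⟩ := ω.exists_le_arrival i e
  have hbound : ∀ m, ω.arrival i m < e → m ≤ b := fun m hm =>
    ((ω.arrival_strictMono i).lt_iff_lt.1 (hm.trans_le hb)).le
  classical
  exact ⟨Nat.findGreatest (ω.arrival i · < e) b,
    Nat.findGreatest_spec (P := (ω.arrival i · < e)) (hbound j h) h,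
    fun m hm => Nat.le_findGreatest (hbound m hm) hm⟩

end JobSequence

namespace Schedule

variable {M N : ℕ}

/-- The set of times at which some job of task `i` is executed. -/
def taskRunSet (σ : Schedule M N) (i : Fin N) : Set ℝ := ⋃ j, σ.runSet (i, j)

/-- The work done on task `i` during `[s, e)`, i.e. the time for which it is executed. -/
noncomputable def work (σ : Schedule M N) (i : Fin N) (s e : ℝ) : ℝ :=
  occupancy (σ.taskRunSet i) s e

/-- The interference with task `k` during `[s, e)`: the work done on all tasks of higher
priority, whether or not task `k` is active. -/
noncomputable def interference (σ : Schedule M N) (k : Fin N) (s e : ℝ) : ℝ :=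
  ∑ i ∈ Finset.Iio k, σ.work i s e

/-- Task `i` has no carry-in at time `s`: all of its jobs that arrived before `s` are finished. -/
def NoCarryIn (σ : Schedule M N) {τ : TaskSystem N} (ω : JobSequence τ) (i : Fin N)
    (s : ℝ) : Prop :=
  ∀ j, ω.arrival i j < s → ¬ σ.Pending ω i j s

variable {σ : Schedule M N} {τ : TaskSystem N} {ω : JobSequence τ} {i k : Fin N} {j : ℕ}
  {r s t e : ℝ}

theorem service_mono (σ : Schedule M N) (J : Fin N × ℕ) : Monotone (σ.service J) :=
  fun _ _ h => occupancy_mono le_rfl h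

theorem Pending.of_le (h : σ.Pending ω i j t) (hst : s ≤ t) (hs : ω.arrival i j ≤ s) :
    σ.Pending ω i j s :=
  ⟨hs, (σ.service_mono (i, j) hst).trans_lt h.2⟩

theorem work_nonneg : 0 ≤ σ.work i s e := occupancy_nonneg

theorem interference_add_work_le (hik : i < k) :
    σ.interference i s e + σ.work i s e ≤ σ.interference k s e := by
  rw [interference, Finset.sum_Iio_add_eq_sum_Iic (f := fun i' => σ.work i' s e) i]
  have hsubset : Finset.Iic i ⊆ Finset.Iio k := fun i' hi' =>
    Finset.mem_Iio.2 ((Finset.mem_Iic.1 hi').trans_lt hik)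
  exact Finset.sum_le_sum_of_subset_of_nonneg hsubset fun _ _ _ => work_nonneg

theorem exists_noCarryIn_active (σ : Schedule M N) (ω : JobSequence τ) (i : Fin N)
    (ht : 0 ≤ t) :
    ∃ s ∈ Set.Icc 0 t, σ.NoCarryIn ω i s ∧ ∀ x ∈ Set.Ico s t, σ.Active ω i x := by
  obtain ⟨n, hn⟩ : ∃ n, ∀ j, ω.arrival i j < t → j < n :=
    (ω.exists_le_arrival i t).imp fun n hn j hj =>
      (ω.arrival_strictMono i).lt_iff_lt.1 (hj.trans_le hn)
  induction n generalizing t with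
  | zero => exact ⟨t, ⟨ht, le_rfl⟩, fun j hj => absurd (hn j hj) j.not_lt_zero, by simp⟩
  | succ n ih =>
    by_cases hclean : σ.NoCarryIn ω i t
    · exact ⟨t, ⟨ht, le_rfl⟩, hclean, by simp⟩
    obtain ⟨j, hjt, hpend⟩ : ∃ j, ω.arrival i j < t ∧ σ.Pending ω i j t := by
      simpa [NoCarryIn] using hclean
    obtain ⟨s, hs, hsclean, hactive⟩ := ih (ω.zero_le_arrival i j) fun j' hj' =>
      ((ω.arrival_strictMono i).lt_iff_lt.1 hj').trans_le (Nat.lt_succ_iff.1 (hn j hjt))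
    refine ⟨s, ⟨hs.1, hs.2.trans hjt.le⟩, hsclean, fun x hx => ?_⟩
    rcases lt_or_ge x (ω.arrival i j) with hxj | hjx
    · exact hactive x ⟨hx.1, hxj⟩
    · exact ⟨j, hpend.of_le hx.2.le hjx⟩

namespace IsGlobalFP

theorem measurableSet_taskRunSet (h : σ.IsGlobalFP ω) (i : Fin N) :
    MeasurableSet (σ.taskRunSet i) :=
  .iUnion fun _ => h.measurableSet_runSet _

theorem work_add (h : σ.IsGlobalFP ω) (i : Fin N) (hrs : r ≤ s) (hse : s ≤ e) :
    σ.work i r s + σ.work i s e = σ.work i r e :=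
  occupancy_add (h.measurableSet_taskRunSet i) hrs hse

theorem interference_add (h : σ.IsGlobalFP ω) (k : Fin N) (hrs : r ≤ s) (hse : s ≤ e) :
    σ.interference k r s + σ.interference k s e = σ.interference k r e := by
  simp only [interference, ← Finset.sum_add_distrib, h.work_add _ hrs hse]

theorem pending_of_mem_runSet (h : σ.IsGlobalFP ω) (ht : t ∈ σ.runSet (i, j)) :
    σ.Pending ω i j t :=
  ht.elim fun p hp => h.pending p t i j hp

theorem service_le_exec (h : σ.IsGlobalFP ω) (i : Fin N) (j : ℕ) (t : ℝ) :
    σ.service (i, j) t ≤ ω.exec i j := by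
  by_contra! hlt
  have hzero : σ.service (i, j) 0 = 0 := by simp [service]
  obtain ⟨s, hs⟩ : ω.exec i j ∈ Set.range (σ.service (i, j)) :=
    mem_range_of_exists_le_of_exists_ge (continuous_occupancy (σ.runSet (i, j)) 0)
      ⟨0, hzero.trans_le (ω.exec_nonneg i j)⟩ ⟨t, hlt.le⟩
  have hidle : occupancy (σ.runSet (i, j)) s t = 0 := occupancy_eq_zero fun x hx hrun =>
    ((h.pending_of_mem_runSet hrun).2.trans_eq hs.symm).not_ge (σ.service_mono (i, j) hx.1)
  have hsplit : σ.service (i, j) t ≤ σ.service (i, j) s + occupancy (σ.runSet (i, j)) s t :=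
    occupancy_le_add _ 0 s t
  linarith

theorem occupancy_runSet_le (h : σ.IsGlobalFP ω) (i : Fin N) (j : ℕ) (hs : 0 ≤ s) :
    occupancy (σ.runSet (i, j)) s e ≤ τ.C i :=
  ((occupancy_mono hs le_rfl).trans (h.service_le_exec i j e)).trans (ω.exec_le i j)

theorem le_card_higher_running [∀ i, DecidablePred (· ∈ σ.taskRunSet i)] (h : σ.IsGlobalFP ω)
    (hactive : σ.Active ω i t) (hrun : t ∉ σ.taskRunSet i) :
    M ≤ Finset.card {i' ∈ Finset.Iio i | t ∈ σ.taskRunSet i'} := by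
  have hpriority := h.priority t i hactive fun p j hp => hrun (Set.mem_iUnion.2 ⟨j, p, hp⟩)
  choose task job hlt htask using hpriority
  have hinj : Function.Injective task := fun p q hpq =>
    h.sequential p q t (task p) (job p) (job q) (htask p) (hpq ▸ htask q)
  refine (Finset.card_fin M).ge.trans (Finset.card_le_card_of_injOn task (fun p _ => ?_) hinj.injOn)
  exact Finset.mem_filter.2 ⟨Finset.mem_Iio.2 (hlt p), Set.mem_iUnion.2 ⟨job p, p, htask p⟩⟩

theorem mul_sub_work_le_interference (h : σ.IsGlobalFP ω) (hse : s ≤ e)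
    (hactive : ∀ t ∈ Set.Ico s e, σ.Active ω i t) :
    M * (e - s - σ.work i s e) ≤ σ.interference i s e := by
  classical
  rw [work, ← occupancy_compl (h.measurableSet_taskRunSet i) hse]
  exact mul_occupancy_le_sum_occupancy (fun i' _ => h.measurableSet_taskRunSet i')
    fun t ht hrun => h.le_card_higher_running (hactive t ht) hrun

theorem exists_window_start (h : σ.IsGlobalFP ω) (k : Fin N) (μ : ℝ) (hs : 0 ≤ s) :
    ∃ t₀ ∈ Set.Icc 0 s, μ * (s - t₀) ≤ σ.interference k t₀ s ∧
      ∀ r ∈ Set.Ico 0 t₀, σ.interference k r t₀ < μ * (t₀ - r) := by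
  have hcont : Continuous fun t => σ.interference k 0 t - μ * t :=
    (continuous_finsetSum _ fun i _ => continuous_occupancy _ 0).sub (by fun_prop)
  obtain ⟨t₀, ht₀, hmin, hfirst⟩ := exists_first_isMinOn_Icc hs hcont.continuousOn
  refine ⟨t₀, ht₀, ?_, fun r hr => ?_⟩
  · have hle : σ.interference k 0 t₀ - μ * t₀ ≤ σ.interference k 0 s - μ * s :=
      hmin (Set.right_mem_Icc.2 hs)
    linarith [h.interference_add k ht₀.1 ht₀.2]
  · linarith [hfirst r hr, h.interference_add k hr.1 hr.2.le]

end IsGlobalFP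

namespace NoCarryIn

theorem le_arrival (hs : σ.NoCarryIn ω i s) (h : σ.IsGlobalFP ω) (hst : s ≤ t)
    (ht : t ∈ σ.runSet (i, j)) : s ≤ ω.arrival i j := by
  by_contra! hlt
  exact hs j hlt ((h.pending_of_mem_runSet ht).of_le hst hlt.le)

theorem work_le_util_mul_add (hs : σ.NoCarryIn ω i s) (h : σ.IsGlobalFP ω) (h0 : 0 ≤ s) {n : ℕ}
    (hsn : s ≤ ω.arrival i n) (hlast : ∀ t ∈ Set.Ico s e, ∀ j, t ∈ σ.runSet (i, j) → j ≤ n) :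
    σ.work i s e ≤ τ.util i * (ω.arrival i n - s) + occupancy (σ.runSet (i, n)) s e := by
  obtain ⟨a, hsa, hfirst⟩ : ∃ a, s ≤ ω.arrival i a ∧ ∀ j, s ≤ ω.arrival i j → a ≤ j := by
    classical
    have hex : ∃ a, s ≤ ω.arrival i a := ⟨n, hsn⟩
    exact ⟨Nat.find hex, Nat.find_spec hex, fun j => Nat.find_min' hex⟩
  have han : a ≤ n := hfirst n hsn
  have hcover : ∀ t ∈ Set.Ico s e, t ∈ σ.taskRunSet i →
      ∃ j ∈ Finset.Ico a (n + 1), t ∈ σ.runSet (i, j) := fun t ht hrun => by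
    obtain ⟨j, hj⟩ := Set.mem_iUnion.1 hrun
    exact ⟨j, Finset.mem_Ico.2 ⟨hfirst j (hs.le_arrival h ht.1 hj),
      Nat.lt_succ_of_le (hlast t ht j hj)⟩, hj⟩
  have hgap : ((n : ℝ) - a) * τ.T i ≤ ω.arrival i n - s := by linarith [ω.sub_mul_T_le i han]
  have hearlier : ∑ j ∈ Finset.Ico a n, occupancy (σ.runSet (i, j)) s e
      ≤ τ.util i * (ω.arrival i n - s) :=
    calc ∑ j ∈ Finset.Ico a n, occupancy (σ.runSet (i, j)) s e
        ≤ (Finset.Ico a n).card • τ.C i :=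
          Finset.sum_le_card_nsmul _ _ _ fun j _ => h.occupancy_runSet_le i j h0
      _ = τ.util i * (((n : ℝ) - a) * τ.T i) := by
          rw [Nat.card_Ico, nsmul_eq_mul, Nat.cast_sub han, ← τ.util_mul_T i]; ring
      _ ≤ τ.util i * (ω.arrival i n - s) := mul_le_mul_of_nonneg_left hgap (τ.util_nonneg i)
  calc σ.work i s e ≤ ∑ j ∈ Finset.Ico a (n + 1), occupancy (σ.runSet (i, j)) s e :=
        occupancy_le_sum_of_subset_biUnion hcover
    _ ≤ _ := by rw [Finset.sum_Ico_succ_top han]; gcongr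

theorem work_le (hs : σ.NoCarryIn ω i s) (h : σ.IsGlobalFP ω) (h0 : 0 ≤ s) (hse : s ≤ e) :
    σ.work i s e ≤ τ.util i * (e - s) + τ.C i * (1 - τ.util i) := by
  have hU := τ.util_nonneg i
  have hU' : 0 ≤ 1 - τ.util i := sub_nonneg.2 (τ.util_le_one i)
  by_cases hjob : ∃ j, s ≤ ω.arrival i j ∧ ω.arrival i j < e
  · obtain ⟨j, hsj, hje⟩ := hjob
    obtain ⟨n, hne, hlast⟩ := ω.exists_last_arrival_lt i hje
    have hsn : s ≤ ω.arrival i n :=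
      hsj.trans ((ω.arrival_strictMono i).monotone (hlast j hje))
    have hwork := hs.work_le_util_mul_add h h0 hsn fun t ht j hj =>
      hlast j ((h.pending_of_mem_runSet hj).1.trans_lt ht.2)
    set x := occupancy (σ.runSet (i, n)) s e
    have hxC : x ≤ τ.C i := h.occupancy_runSet_le i n h0
    have hxe : x ≤ e - ω.arrival i n := by
      have hidle : occupancy (σ.runSet (i, n)) s (ω.arrival i n) = 0 :=
        occupancy_eq_zero fun t ht hrun => ht.2.not_ge (h.pending_of_mem_runSet hrun).1
      linarith [occupancy_le_add (σ.runSet (i, n)) s (ω.arrival i n) e,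
        occupancy_le_sub (R := σ.runSet (i, n)) hne.le]
    linarith [mul_le_mul_of_nonneg_left hxe hU, mul_le_mul_of_nonneg_right hxC hU']
  · have hidle : σ.work i s e = 0 := occupancy_eq_zero fun t ht hrun => by
      obtain ⟨j, hj⟩ := Set.mem_iUnion.1 hrun
      exact hjob ⟨j, hs.le_arrival h ht.1 hj, (h.pending_of_mem_runSet hj).1.trans_lt ht.2⟩
    rw [hidle]
    exact add_nonneg (mul_nonneg hU (sub_nonneg.2 hse)) (mul_nonneg (τ.C_pos i).le hU')

theorem work_lt_of_miss (hs : σ.NoCarryIn ω k s) (h : σ.IsGlobalFP ω) (h0 : 0 ≤ s)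
    (hsj : s ≤ ω.arrival k j)
    (hmiss : σ.service (k, j) (ω.arrival k j + τ.D k) < ω.exec k j) :
    σ.work k s (ω.arrival k j + τ.D k) < τ.density k * (ω.arrival k j + τ.D k - s) := by
  set e := ω.arrival k j + τ.D k with he
  have hlast : ∀ t ∈ Set.Ico s e, ∀ m, t ∈ σ.runSet (k, m) → m ≤ j := by
    rintro t ht m ⟨p, hp⟩
    by_contra! hjm
    have hjt : ω.arrival k j ≤ t :=
      (ω.arrival_strictMono k hjm).le.trans (h.pending p t k m hp).1
    exact h.fifo p t k m hp j hjm ⟨hjt, (σ.service_mono (k, j) ht.2.le).trans_lt hmiss⟩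
  have hjob : occupancy (σ.runSet (k, j)) s e < τ.C k :=
    ((occupancy_mono h0 le_rfl).trans_lt hmiss).trans_le (ω.exec_le k j)
  calc σ.work k s e ≤ τ.util k * (ω.arrival k j - s) + occupancy (σ.runSet (k, j)) s e :=
        hs.work_le_util_mul_add h h0 hsj hlast
    _ < τ.density k * (ω.arrival k j - s) + τ.density k * τ.D k :=
        add_lt_add_of_le_of_lt
          (mul_le_mul_of_nonneg_right (τ.util_le_density k) (sub_nonneg.2 hsj))
          (hjob.trans_le (τ.C_le_density_mul_D k))
    _ = τ.density k * (e - s) := by rw [he]; ring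

end NoCarryIn

namespace IsGlobalFP

theorem exists_lt_interference_of_miss (h : σ.IsGlobalFP ω) (hM : 0 < M)
    (hmiss : σ.service (k, j) (ω.arrival k j + τ.D k) < ω.exec k j) :
    ∃ s ∈ Set.Icc 0 (ω.arrival k j), M * (1 - τ.density k) * (ω.arrival k j + τ.D k - s)
      < σ.interference k s (ω.arrival k j + τ.D k) := by
  obtain ⟨s, hs, hclean, hactive⟩ :=
    exists_noCarryIn_active σ ω k (ω.zero_le_arrival k j)
  set e := ω.arrival k j + τ.D k
  have hactive_window : ∀ t ∈ Set.Ico s e, σ.Active ω k t := fun t ht => by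
    rcases lt_or_ge t (ω.arrival k j) with htj | hjt
    · exact hactive t ⟨ht.1, htj⟩
    · exact ⟨j, hjt, (σ.service_mono (k, j) ht.2.le).trans_lt hmiss⟩
  have hse : s ≤ e := by linarith [hs.2, τ.D_pos k]
  refine ⟨s, hs, ?_⟩
  calc M * (1 - τ.density k) * (e - s) = M * (e - s - τ.density k * (e - s)) := by ring
    _ < M * (e - s - σ.work k s e) := by
        have := hclean.work_lt_of_miss h hs.1 hs.2 hmiss
        gcongr
    _ ≤ σ.interference k s e := h.mul_sub_work_le_interference hse hactive_window

theorem work_le_of_interference_lt (h : σ.IsGlobalFP ω) (hM : 0 < M) (hik : i < k) {ρ : ℝ}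
    (hρ : τ.util i ≤ ρ) (ht : 0 ≤ t) (hte : t ≤ e)
    (hlt : ∀ r ∈ Set.Ico 0 t, σ.interference k r t < (M - (M - 1) * ρ) * (t - r)) :
    σ.work i t e ≤ τ.util i * (e - t) + τ.C i * (1 - τ.util i) := by
  obtain ⟨r, hr, hclean, hactive⟩ := exists_noCarryIn_active σ ω i ht
  have hwork := hclean.work_le h hr.1 (hr.2.trans hte)
  rcases hr.2.eq_or_lt with rfl | hrt
  · exact hwork
  have hM' : (0 : ℝ) ≤ M - 1 := sub_nonneg.2 (Nat.one_le_cast.2 hM)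
  have hrate : ρ * (t - r) < σ.work i r t := by
    refine lt_of_mul_lt_mul_left ?_ hM'
    linarith [h.mul_sub_work_le_interference hr.2 hactive, hlt r ⟨hr.1, hrt⟩,
      interference_add_work_le (σ := σ) (s := r) (e := t) hik]
  linarith [h.work_add i hr.2 hte, mul_le_mul_of_nonneg_right hρ (sub_nonneg.2 hr.2)]

end IsGlobalFP

end Schedule

namespace TaskSystem

variable {N M : ℕ} {τ : TaskSystem N} {k : Fin N}

theorem util_mul_add_le_mul (τ : TaskSystem N) (i : Fin N) {d x : ℝ} (hd : 0 < d) (hx : d ≤ x) :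
    τ.util i * x + τ.C i * (1 - τ.util i)
      ≤ ((τ.C i - τ.C i * τ.util i) / d + τ.util i) * x := by
  have hburst : 0 ≤ τ.C i - τ.C i * τ.util i := by
    linarith [mul_le_of_le_one_right (τ.C_pos i).le (τ.util_le_one i)]
  have hscale : τ.C i - τ.C i * τ.util i ≤ (τ.C i - τ.C i * τ.util i) / d * x := by
    rw [div_mul_eq_mul_div, le_div_iff₀ hd]
    exact mul_le_mul_of_nonneg_left hx hburst
  linarith

theorem PassesTest.schedulable (hM : 0 < M) (htest : τ.PassesTest M k) : τ.Schedulable M k := by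
  intro ω σ h j
  by_contra! hmiss
  obtain ⟨s, hs, hbusy⟩ := h.exists_lt_interference_of_miss hM hmiss
  set e := ω.arrival k j + τ.D k
  set ρ := τ.maxUtilDensity k
  set μ : ℝ := M - (M - 1) * ρ
  obtain ⟨t₀, ht₀, hgain, hlt⟩ := h.exists_window_start k μ hs.1
  have hDe : τ.D k ≤ e - t₀ := by linarith [hs.2, ht₀.2]
  have hte : t₀ ≤ e := by linarith [τ.D_pos k]
  have hupper : σ.interference k t₀ e ≤ (μ - τ.density k) * (e - t₀) :=
    calc σ.interference k t₀ e
        ≤ ∑ i ∈ Finset.Iio k, ((τ.C i - τ.C i * τ.util i) / τ.D k + τ.util i) * (e - t₀) :=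
          Finset.sum_le_sum fun i hi =>
            have hik := Finset.mem_Iio.1 hi
            (h.work_le_of_interference_lt hM hik (τ.util_le_maxUtilDensity hik) ht₀.1 hte hlt).trans
              (τ.util_mul_add_le_mul i (τ.D_pos k) hDe)
      _ ≤ (μ - τ.density k) * (e - t₀) := by
          rw [← Finset.sum_mul]
          exact mul_le_mul_of_nonneg_right (le_sub_iff_add_le'.2 htest) (sub_nonneg.2 hte)
  have hlower : (μ - τ.density k) * (e - t₀) < σ.interference k t₀ e := by
    have hrate : μ - τ.density k ≤ M * (1 - τ.density k) := by
      have hM' : (0 : ℝ) ≤ M - 1 := sub_nonneg.2 (Nat.one_le_cast.2 hM)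
      linarith [mul_le_mul_of_nonneg_left (τ.density_le_maxUtilDensity k) hM']
    have hse : s ≤ e := by linarith [hs.2, τ.D_pos k]
    linarith [h.interference_add k ht₀.2 hse,
      mul_le_mul_of_nonneg_right hrate (sub_nonneg.2 hse),
      mul_nonneg (τ.density_nonneg k) (sub_nonneg.2 ht₀.2)]
  exact hlower.not_ge hupper

end TaskSystem

namespace RealRAM

/-- Started in configuration `s`, the program `P` passes within `n` steps through a configuration
that satisfies `Q`. -/
def ReachesWithin (P : Program) (n : ℕ) (s : Config) (Q : Config → Prop) : Prop :=
  ∃ m ≤ n, Q ((step P)^[m] s)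

namespace ReachesWithin

variable {P : Program} {m n pc a b z : ℕ} {s : Config} {reg : ℕ → ℝ} {idx : ℕ → ℕ} {mem : ℕ → ℝ}
  {Q Q' : Config → Prop}

theorem refl (h : Q s) : ReachesWithin P n s Q := ⟨0, n.zero_le, h⟩

theorem mono (h : ReachesWithin P m s Q) (hmn : m ≤ n) : ReachesWithin P n s Q :=
  h.imp fun _ ⟨ht, hQ⟩ => ⟨ht.trans hmn, hQ⟩

theorem bind (h : ReachesWithin P m s Q) (h' : ∀ s', Q s' → ReachesWithin P n s' Q') :
    ReachesWithin P (m + n) s Q' := by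
  obtain ⟨t, ht, hQ⟩ := h
  obtain ⟨t', ht', hQ'⟩ := h' _ hQ
  exact ⟨t' + t, by omega, by rwa [Function.iterate_add_apply]⟩

theorem head {ins : Instr} (hout : s.out = none) (hins : P[s.pc]? = some ins)
    (h : ReachesWithin P n (ins.exec s) Q) : ReachesWithin P (n + 1) s Q := by
  obtain ⟨t, ht, hQ⟩ := h
  refine ⟨t + 1, by omega, ?_⟩
  rw [Function.iterate_succ_apply]
  simpa only [step, hout, hins] using hQ

theorem assign_max (hjump : P[pc]? = some (.jle a b (pc + 2)))
    (hmove : P[pc + 1]? = some (.arith .add b a z)) (hz : reg z = 0)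
    (h : ReachesWithin P n
      ⟨pc + 2, Function.update reg b (max (reg a) (reg b)), idx, mem, none⟩ Q) :
    ReachesWithin P (n + 2) ⟨pc, reg, idx, mem, none⟩ Q := by
  refine head rfl hjump ?_
  rcases le_or_gt (reg a) (reg b) with hle | hlt
  · rw [max_eq_right hle, Function.update_eq_self] at h
    simpa only [Instr.exec, if_pos hle] using h.mono n.le_succ
  · rw [max_eq_left hlt.le] at h
    simp only [Instr.exec, if_neg hlt.not_ge]
    exact head rfl hmove (by simpa only [Instr.exec, Op.eval, hz, add_zero] using h)

theorem assign_min (hjump : P[pc]? = some (.jle b a (pc + 2)))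
    (hmove : P[pc + 1]? = some (.arith .add b a z)) (hz : reg z = 0)
    (h : ReachesWithin P n
      ⟨pc + 2, Function.update reg b (min (reg a) (reg b)), idx, mem, none⟩ Q) :
    ReachesWithin P (n + 2) ⟨pc, reg, idx, mem, none⟩ Q := by
  refine head rfl hjump ?_
  rcases le_or_gt (reg b) (reg a) with hle | hlt
  · rw [min_eq_right hle, Function.update_eq_self] at h
    simpa only [Instr.exec, if_pos hle] using h.mono n.le_succ
  · rw [min_eq_left hlt.le] at h
    simp only [Instr.exec, if_neg hlt.not_ge]
    exact head rfl hmove (by simpa only [Instr.exec, Op.eval, hz, add_zero] using h)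

theorem answer_le (hjump : P[pc]? = some (.jle a b (pc + 2)))
    (hno : P[pc + 1]? = some (.halt false)) (hyes : P[pc + 2]? = some (.halt true)) {A : Prop}
    (hA : reg a ≤ reg b ↔ A) :
    ReachesWithin P 2 ⟨pc, reg, idx, mem, none⟩ fun s =>
      ∃ answer : Bool, s.out = some answer ∧ (answer = true ↔ A) := by
  refine head rfl hjump ?_
  by_cases hle : reg a ≤ reg b
  · simp only [Instr.exec, if_pos hle]
    exact head rfl hyes (refl ⟨true, rfl, by simpa [← hA] using hle⟩)
  · simp only [Instr.exec, if_neg hle]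
    exact head rfl hno (refl ⟨false, rfl, by simpa [← hA] using hle⟩)

end ReachesWithin

/-- The utilization of task `i`, as computed from a memory with the layout of `TaskSystem.input`. -/
noncomputable def memUtil (x : ℕ → ℝ) (i : ℕ) : ℝ := x (3 * i + 1) / x (3 * i + 3)

/-- The density of task `k`, as computed from a memory with the layout of `TaskSystem.input`. -/
noncomputable def memDensity (x : ℕ → ℝ) (k : ℕ) : ℝ :=
  x (3 * k + 1) / min (x (3 * k + 2)) (x (3 * k + 3))

/-- The left-hand side of the test for task `k`, with the sum cut off after the first `n` tasks. -/
noncomputable def memLoad (x : ℕ → ℝ) (k n : ℕ) : ℝ :=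
  memDensity x k + ∑ i ∈ Finset.range n,
    ((x (3 * i + 1) - x (3 * i + 1) * memUtil x i) / x (3 * k + 2) + memUtil x i)

/-- The maximum of the density of task `k` and the utilizations of the first `n` tasks. -/
noncomputable def memMaxUtil (x : ℕ → ℝ) (k n : ℕ) : ℝ :=
  (Finset.range n).fold max (memDensity x k) (memUtil x)

theorem memLoad_succ (x : ℕ → ℝ) (k n : ℕ) :
    memLoad x k (n + 1) = memLoad x k n +
      ((x (3 * n + 1) - x (3 * n + 1) * memUtil x n) / x (3 * k + 2) + memUtil x n) := by
  rw [memLoad, memLoad, Finset.sum_range_succ, add_assoc]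

theorem memMaxUtil_succ (x : ℕ → ℝ) (k n : ℕ) :
    memMaxUtil x k (n + 1) = max (memUtil x n) (memMaxUtil x k n) := by
  rw [memMaxUtil, Finset.range_add_one, Finset.fold_insert Finset.notMem_range_self, memMaxUtil]

/-- The program of the linear-time test for task `k`: initialization, a loop over the tasks
`i < k` from address `14` on, and the final comparison from address `29` on.

Index registers: `0` holds `k`, `1` the number one, `2` the pointer value `3 * k` at which the loop
ends, and `3` a pointer into the memory. Real registers: `0` is never written and holds zero, `2`
holds the deadline of task `k`, `4` the sum and `5` the maximum accumulated so far, and `1`, `3`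
and `6` are temporary. -/
def testProgram : Program :=
  [.iconst 1 1,
   .iadd 2 0 0,
   .iadd 2 2 0,
   .iadd 3 2 1,
   .load 1 3,
   .iadd 3 3 1,
   .load 2 3,
   .iadd 3 3 1,
   .load 3 3,
   .jle 3 2 11,
   .arith .add 3 2 0,
   .arith .div 4 1 3,
   .arith .add 5 4 0,
   .iconst 3 0,
   .ijle 2 3 29,
   .iadd 3 3 1,
   .load 1 3,
   .iadd 3 3 1,
   .iadd 3 3 1,
   .load 3 3,
   .arith .div 3 1 3,
   .arith .mul 6 1 3,
   .arith .sub 6 1 6,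
   .arith .div 6 6 2,
   .arith .add 6 6 3,
   .arith .add 4 4 6,
   .jle 3 5 28,
   .arith .add 5 3 0,
   .ijle 0 0 14,
   .iconst 3 0,
   .load 1 3,
   .const 2 1,
   .arith .sub 3 1 2,
   .arith .mul 3 3 5,
   .arith .sub 3 1 3,
   .jle 4 3 37,
   .halt false,
   .halt true]

/-- The loop invariant of `testProgram` for task `k` and memory `x`: the configuration `s` is at
the head of the loop and the first `n` tasks have been processed. -/
structure LoopInvariant (x : ℕ → ℝ) (k n : ℕ) (s : Config) : Prop where
  pc : s.pc = 14
  mem : s.mem = x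
  out : s.out = none
  one : s.idx 1 = 1
  limit : s.idx 2 = 3 * k
  pointer : s.idx 3 = 3 * n
  zero : s.reg 0 = 0
  deadline : s.reg 2 = x (3 * k + 2)
  load : s.reg 4 = memLoad x k n
  maxUtil : s.reg 5 = memMaxUtil x k n

theorem reaches_loopInvariant_zero (x : ℕ → ℝ) (k : ℕ) :
    ReachesWithin testProgram 14 (init k x) (LoopInvariant x k 0) := by
  have hlimit : k + k + k = 3 * k := by ring
  iterate 9 refine .head rfl rfl ?_
  refine .assign_min rfl rfl rfl ?_
  iterate 3 refine .head rfl rfl ?_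
  refine .refl ?_
  constructor <;> simp [Instr.exec, Op.eval, init, hlimit, memLoad, memMaxUtil, memDensity]

namespace LoopInvariant

variable {x : ℕ → ℝ} {k n : ℕ} {s : Config}

theorem reaches_succ (h : LoopInvariant x k n s) (hn : n < k) :
    ReachesWithin testProgram 15 s (LoopInvariant x k (n + 1)) := by
  obtain ⟨pc, reg, idx, mem, out⟩ := s
  obtain ⟨rfl, rfl, rfl, hone, hlimit, hpointer, hzero, hdeadline, hload, hmax⟩ := h
  dsimp only at *
  refine .head rfl rfl ?_
  rw [Instr.exec, if_neg (by simp only [hlimit, hpointer]; omega)]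
  iterate 11 refine .head rfl rfl ?_
  refine .assign_max rfl rfl hzero (.head rfl rfl (.refl ?_))
  constructor <;>
    simp [Instr.exec, Op.eval, mul_add, add_assoc, memLoad_succ, memMaxUtil_succ, memUtil, *]

theorem reaches_answer (h : LoopInvariant x k k s) :
    ReachesWithin testProgram 9 s fun s' => ∃ answer : Bool, s'.out = some answer ∧
      (answer = true ↔ memLoad x k k ≤ x 0 - (x 0 - 1) * memMaxUtil x k k) := by
  obtain ⟨pc, reg, idx, mem, out⟩ := s
  obtain ⟨rfl, rfl, rfl, -, hlimit, hpointer, -, -, hload, hmax⟩ := h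
  dsimp only at *
  refine .head rfl rfl ?_
  rw [Instr.exec, if_pos (by simp only [hlimit, hpointer, le_refl])]
  iterate 6 refine .head rfl rfl ?_
  refine .answer_le rfl rfl rfl ?_
  simp [Instr.exec, Op.eval, *]

end LoopInvariant

theorem reaches_loopInvariant (x : ℕ → ℝ) {k n : ℕ} (hn : n ≤ k) :
    ReachesWithin testProgram (14 + 15 * n) (init k x) (LoopInvariant x k n) := by
  induction n with
  | zero => exact reaches_loopInvariant_zero x k
  | succ n ih => exact (ih (Nat.le_of_succ_le hn)).bind fun _ h => h.reaches_succ hn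

theorem decidesWithin_testProgram (k : ℕ) (x : ℕ → ℝ) :
    DecidesWithin testProgram k x (23 * (k + 1))
      (memLoad x k k ≤ x 0 - (x 0 - 1) * memMaxUtil x k k) :=
  ((reaches_loopInvariant x le_rfl).bind fun _ h => h.reaches_answer).mono (by omega)

end RealRAM

namespace TaskSystem

variable {N : ℕ} (τ : TaskSystem N) (M : ℕ)

theorem input_C (i : Fin N) : τ.input M (3 * i + 1) = τ.C i := by
  simp [input]

theorem input_D (i : Fin N) : τ.input M (3 * i + 2) = τ.D i := by
  have hdiv : (3 * (i : ℕ) + 1) / 3 = i := by omega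
  simp [input, hdiv]

theorem input_T (i : Fin N) : τ.input M (3 * i + 3) = τ.T i := by
  have hdiv : (3 * (i : ℕ) + 2) / 3 = i := by omega
  simp [input, hdiv]

theorem memUtil_input (i : Fin N) : RealRAM.memUtil (τ.input M) i = τ.util i := by
  rw [RealRAM.memUtil, input_C, input_T, util]

theorem memDensity_input (k : Fin N) : RealRAM.memDensity (τ.input M) k = τ.density k := by
  rw [RealRAM.memDensity, input_C, input_D, input_T, density]

theorem memLoad_input (k : Fin N) : RealRAM.memLoad (τ.input M) k k =
    τ.density k + ∑ i ∈ Finset.Iio k, ((τ.C i - τ.C i * τ.util i) / τ.D k + τ.util i) := by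
  simp only [RealRAM.memLoad, ← Nat.Iio_eq_range, ← Fin.map_valEmbedding_Iio, Finset.sum_map,
    Fin.valEmbedding_apply, memDensity_input, memUtil_input, input_C, input_D]

theorem memMaxUtil_input (k : Fin N) :
    RealRAM.memMaxUtil (τ.input M) k k = τ.maxUtilDensity k := by
  simp only [RealRAM.memMaxUtil, ← Nat.Iio_eq_range, ← Fin.map_valEmbedding_Iio, Finset.fold_map,
    Function.comp_def, Fin.valEmbedding_apply, memDensity_input, memUtil_input, maxUtilDensity]

theorem decidesWithin_passesTest (k : Fin N) :
    RealRAM.DecidesWithin RealRAM.testProgram k (τ.input M) (23 * (k + 1)) (τ.PassesTest M k) := by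
  have h := RealRAM.decidesWithin_testProgram k (τ.input M)
  rwa [memLoad_input, memMaxUtil_input] at h

end TaskSystem

theorem theorem4p7_general :
    (∀ (N M : ℕ) (τ : TaskSystem N) (k : Fin N), 0 < M → τ.PassesTest M k → τ.Schedulable M k) ∧
    ∃ (P : RealRAM.Program) (c : ℕ), ∀ (N M : ℕ) (τ : TaskSystem N) (k : Fin N),
      RealRAM.DecidesWithin P k (τ.input M) (c * (k + 1)) (τ.PassesTest M k) :=
  ⟨fun _ _ _ _ hM htest => htest.schedulable hM,
    RealRAM.testProgram, 23, fun _ M τ k => τ.decidesWithin_passesTest M k⟩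

theorem theorem4p7 :
    -- the test is sufficient
    (∀ (N M : ℕ) (τ : TaskSystem N) (k : Fin N), 2 ≤ M →
      τ.PassesTest M k → τ.Schedulable M k) ∧
    -- one fixed program performs the test in a number of steps linear in the number of tasks
    -- of priority at least that of task `k`
    (∃ (P : RealRAM.Program) (c : ℕ), ∀ (N M : ℕ) (τ : TaskSystem N) (k : Fin N), 2 ≤ M →
      RealRAM.DecidesWithin P (k : ℕ) (τ.input M) (c * ((k : ℕ) + 1)) (τ.PassesTest M k)) := by
  obtain ⟨hsuff, P, c, hP⟩ := theorem4p7_general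
  exact ⟨fun N M τ k hM => hsuff N M τ k (by omega), P, c, fun N M τ k _ => hP N M τ k⟩
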